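/- Let $X$ be a finite set with $|X|\ge 2$ and let $X^*$ be the set of finite words over $X$. A self-similar group over $X$ is a group $\mathfrak G$ of length-preserving permutations of $X^*$ such that for all $g\in\mathfrak G$ and $x\in X$ there is $g|_x\in\mathfrak G$ with $g(xw)=g(x)\,g|_x(w)$ for all $w\in X^*$. For a field $K$, its Nekrashevych algebra $\mathcal N_K(\mathfrak G,X)$ is the unital $*$-algebra over $K$ (with $*$ being $K$-linear) generated by $X\cup\mathfrak G$ subject to the relations $g^*=g^{-1}$, $g\cdot h=gh$ (the identity of $\mathfrak G$ being the unit), $gx=g(x)\,g|_x$, $y^*x=\delta_{x,y}$ and $\sum_{x\in X}xx^*=1$ for $g,h\in\mathfrak G$, $x,y\in X$. It is called simple if it is simple as a ring. Let $m\ge 2$, let $C$ be a cyclic group of order $m$, let $\Phi(m-1)$ be the identity automorphism of $C$, and for $0\le k\le m-2$ let $\Phi(k)\colon C\to\mathbb Z_m$ be a homomorphism. Let $c\in C$ act on words over $X=\mathbb Z_m$ by $c(kw)=k\,\Phi(k)(c)(w)$ for $k\in X$ and $w\in X^*$, where $a\in\mathbb Z_m$ acts on words by $a(kw)=(a+k)w$;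 both fix the empty word. Let $\mathfrak G$ be the self-similar group over $\mathbb Z_m$ generated by all these permutations, for $c\in C$ and $a\in \mathbb Z_m$. If $\bigcap_{k=0}^{m-2}\ker\Phi(k)$ is trivial, then $\mathfrak G$ is called a GGS-group. **Theorem.** Let $\mathfrak G$ be a GGS-group over $\mathbb Z_m$, $m\ge 2$. If $\Phi(k)$ is an isomorphism for some $0\le k\le m-2$, then $\mathcal N_K(\mathfrak G,\mathbb Z_m)$ is simple for every field $K$. Otherwise, $\mathcal N_K(\mathfrak G,\mathbb Z_m)$ is simple for no field $K$. In particular, if $m$ is a prime power, then $\mathcal N_K(\mathfrak G,\mathbb Z_m)$ is simple for every field $K$. This applies to the Gupta–Sidki $p$-groups, that is, to the case in which $m=p$ is an odd prime, $C=\langle t\rangle$, $\Phi(0)(t)=1$, $\Phi(1)(t)=-1$ and $\Phi(k)(t)=0$ for $2\le k\le p-2$. -/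

import Mathlib

/-!
Self-similar groups, their Nekrashevych algebras, multispinal groups and GGS-groups.
Words over the alphabet `X` are elements of `List X`.
-/

universe u v

/-- A self-similar group over the alphabet `X`: a group of length-preserving permutations of the
set of words such that each element `g` has, at each letter `x`, a section `h = g|_x` in the
group, that is, `g(xw) = g(x) g|_x(w)` for all words `w`. -/
structure SelfSimilarGroup (X : Type*) where
  /-- the underlying group of permutations of words -/
  carrier : Subgroup (Equiv.Perm (List X))
  /-- the action is length-preserving -/
  length_apply : ∀ g ∈ carrier, ∀ w : List X, (g w).length = w.length
  /-- the group has all sections -/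
  exists_section : ∀ g ∈ carrier, ∀ x : X, ∃ h ∈ carrier, ∀ w : List X, g (x :: w) = g [x] ++ h w

/-! ### The Nekrashevych algebra -/

/-- Generators of the Nekrashevych algebra: the letters `x`, their adjoints `x^*` and the group
elements `g`. As `g^* = g⁻¹`, no adjoints of the latter are needed. -/
inductive NekGen {X : Type*} (G : SelfSimilarGroup X) where
  | letter (x : X) : NekGen G
  | adj (x : X) : NekGen G
  | grp (g : G.carrier) : NekGen G

/-- The letter `x` in the free algebra. -/
def nekX (K : Type*) [Field K] {X : Type*} (G : SelfSimilarGroup X) (x : X) :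
    FreeAlgebra K (NekGen G) :=
  FreeAlgebra.ι K (NekGen.letter x)

/-- The adjoint `x^*` of the letter `x` in the free algebra. -/
def nekXs (K : Type*) [Field K] {X : Type*} (G : SelfSimilarGroup X) (x : X) :
    FreeAlgebra K (NekGen G) :=
  FreeAlgebra.ι K (NekGen.adj x)

/-- The group element `g` in the free algebra. -/
def nekG (K : Type*) [Field K] {X : Type*} (G : SelfSimilarGroup X) (g : G.carrier) :
    FreeAlgebra K (NekGen G) :=
  FreeAlgebra.ι K (NekGen.grp g)

/-- The defining relations of the Nekrashevych algebra. In `ss` and `ss_adj` the hypothesis says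
that `y = g(x)` and `h = g|_x`. The relation `ss_adj` is the adjoint of `ss`; the other relations
form a set closed under taking adjoints. -/
inductive NekRel (K : Type*) [Field K] {X : Type*} [Fintype X] (G : SelfSimilarGroup X) :
    FreeAlgebra K (NekGen G) → FreeAlgebra K (NekGen G) → Prop
  | grp_one : NekRel K G (nekG K G 1) 1
  | grp_mul (g h : G.carrier) : NekRel K G (nekG K G g * nekG K G h) (nekG K G (g * h))
  | ss (g h : G.carrier) (x y : X) (hs : ∀ w : List X, g.1 (x :: w) = y :: h.1 w) :
      NekRel K G (nekG K G g * nekX K G x) (nekX K G y * nekG K G h)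
  | ss_adj (g h : G.carrier) (x y : X) (hs : ∀ w : List X, g.1 (x :: w) = y :: h.1 w) :
      NekRel K G (nekXs K G x * nekG K G g⁻¹) (nekG K G h⁻¹ * nekXs K G y)
  | ck_same (x : X) : NekRel K G (nekXs K G x * nekX K G x) 1
  | ck_diff (x y : X) (hxy : y ≠ x) : NekRel K G (nekXs K G y * nekX K G x) 0
  | ck_sum : NekRel K G (∑ x : X, nekX K G x * nekXs K G x) 1

/-- The Nekrashevych algebra of the self-similar group `G` over the finite alphabet `X`, with
coefficients in the field `K`. -/
abbrev NekrashevychAlgebra (K : Type*) [Field K] {X : Type*} [Fintype X]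
    (G : SelfSimilarGroup X) : Type _ :=
  RingQuot (NekRel K G)

/-! ### Multispinal groups -/

section Multispinal

variable {G H X : Type*} [Group G] [Group H] [MulAction H X]

/-- The letter written by a state of the automaton of `Φ` on reading a letter: states from `H`
act on letters by the given action, states from `G` fix all letters. -/
def msOut : G ⊕ H → X → X
  | Sum.inl _, x => x
  | Sum.inr h, x => h • x

/-- The section of a state at a letter: `h|_x = 1` and `g|_x = Φ(x)(g)`. -/
def msNext (Φ : X → MulAut G ⊕ (G →* H)) : G ⊕ H → X → G ⊕ H
  | Sum.inl g, x =>
    match Φ x with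
    | Sum.inl α => Sum.inl (α g)
    | Sum.inr f => Sum.inr (f g)
  | Sum.inr _, _ => Sum.inr 1

/-- The action of a state on words. The states `inl 1` and `inr 1` both act as the identity (so
identifying them is not necessary). -/
def msAct (Φ : X → MulAut G ⊕ (G →* H)) : G ⊕ H → List X → List X
  | _, [] => []
  | s, x :: w => msOut s x :: msAct Φ (msNext Φ s x) w

/-- The inverse of a state. -/
def msInv : G ⊕ H → G ⊕ H
  | Sum.inl g => Sum.inl g⁻¹
  | Sum.inr h => Sum.inr h⁻¹

theorem msInv_msInv (s : G ⊕ H) : msInv (msInv s) = s := by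
  cases s <;> simp [msInv]

theorem msAct_msInv (Φ : X → MulAut G ⊕ (G →* H)) (s : G ⊕ H) (w : List X) :
    msAct Φ (msInv s) (msAct Φ s w) = w := by
  induction w generalizing s with
  | nil => simp [msAct]
  | cons x w ih =>
    have h1 : msOut (msInv s) (msOut s x) = x := by
      cases s <;> simp [msInv, msOut]
    have h2 : msNext Φ (msInv s) (msOut s x) = msInv (msNext Φ s x) := by
      cases s with
      | inl g =>
        simp only [msInv, msOut, msNext]
        cases Φ x <;> simp
      | inr h => simp [msInv, msNext]
    simp only [msAct]
    rw [h1, h2, ih]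

/-- The permutation of words given by a state. -/
def msPerm (Φ : X → MulAut G ⊕ (G →* H)) (s : G ⊕ H) : Equiv.Perm (List X) where
  toFun := msAct Φ s
  invFun := msAct Φ (msInv s)
  left_inv := msAct_msInv Φ s
  right_inv w := by
    have h := msAct_msInv Φ (msInv s) w
    rwa [msInv_msInv] at h

theorem length_msAct (Φ : X → MulAut G ⊕ (G →* H)) (s : G ⊕ H) (w : List X) :
    (msAct Φ s w).length = w.length := by
  induction w generalizing s with
  | nil => rfl
  | cons x w ih => simp [msAct, ih]

theorem length_of_mem_closure (Φ : X → MulAut G ⊕ (G →* H)) (g : Equiv.Perm (List X))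
    (hg : g ∈ Subgroup.closure (Set.range (msPerm Φ))) (w : List X) :
    (g w).length = w.length := by
  induction hg using Subgroup.closure_induction generalizing w with
  | mem g hg =>
    obtain ⟨s, rfl⟩ := hg
    exact length_msAct Φ s w
  | one => rfl
  | mul a b _ _ iha ihb => rw [Equiv.Perm.mul_apply, iha, ihb]
  | inv a _ iha =>
    have h := iha (a⁻¹ w)
    rw [show a (a⁻¹ w) = w from Equiv.apply_symm_apply a w] at h
    exact h.symm

theorem exists_section_of_mem_closure (Φ : X → MulAut G ⊕ (G →* H)) (g : Equiv.Perm (List X))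
    (hg : g ∈ Subgroup.closure (Set.range (msPerm Φ))) (x : X) :
    ∃ h ∈ Subgroup.closure (Set.range (msPerm Φ)), ∀ w : List X, g (x :: w) = g [x] ++ h w := by
  induction hg using Subgroup.closure_induction generalizing x with
  | mem g hg =>
    obtain ⟨s, rfl⟩ := hg
    exact ⟨msPerm Φ (msNext Φ s x), Subgroup.subset_closure ⟨_, rfl⟩, fun w => rfl⟩
  | one => exact ⟨1, one_mem _, fun w => rfl⟩
  | mul a b _ hb iha ihb =>
    obtain ⟨k, hk, hkw⟩ := ihb x
    obtain ⟨y, hy⟩ := List.length_eq_one_iff.1 (length_of_mem_closure Φ b hb [x])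
    obtain ⟨l, hl, hlw⟩ := iha y
    refine ⟨l * k, mul_mem hl hk, fun w => ?_⟩
    rw [Equiv.Perm.mul_apply, hkw, Equiv.Perm.mul_apply, hy, Equiv.Perm.mul_apply]
    exact hlw (k w)
  | inv a ha iha =>
    obtain ⟨y, hy⟩ := List.length_eq_one_iff.1 (length_of_mem_closure Φ a⁻¹ (inv_mem ha) [x])
    obtain ⟨l, hl, hlw⟩ := iha y
    have hay : a [y] = [x] := by rw [← hy]; exact Equiv.apply_symm_apply a [x]
    refine ⟨l⁻¹, inv_mem hl, fun w => ?_⟩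
    rw [Equiv.Perm.inv_eq_iff_eq, hy, List.singleton_append, hlw, hay, show l (l⁻¹ w) = w from Equiv.apply_symm_apply l w]
    rfl

/-- The self-similar group over `X` generated by the states of the automaton of `Φ`. -/
def multispinalGroup (Φ : X → MulAut G ⊕ (G →* H)) : SelfSimilarGroup X where
  carrier := Subgroup.closure (Set.range (msPerm Φ))
  length_apply := length_of_mem_closure Φ
  exists_section := exists_section_of_mem_closure Φ

/-- The group `A` of automorphisms of `G` generated by the automorphisms among the `Φ(x)`. -/
def msA (Φ : X → MulAut G ⊕ (G →* H)) : Subgroup (MulAut G) :=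
  Subgroup.closure {α | ∃ x, Φ x = Sum.inl α}

/-- The set `B` of all `f ∘ α` with `f` a homomorphism `G → H` among the `Φ(x)` and `α ∈ A`. -/
def msB (Φ : X → MulAut G ⊕ (G →* H)) : Set (G →* H) :=
  {b | ∃ f : G →* H, (∃ x, Φ x = Sum.inr f) ∧ ∃ α ∈ msA Φ, b = f.comp α.toMonoidHom}

/-- The requirements on the data `(G, H, Φ)` of a multispinal group over the alphabet `X`. -/
structure IsMultispinal (Φ : X → MulAut G ⊕ (G →* H)) : Prop where
  finite_left : Finite G
  finite_right : Finite H
  /-- `H` acts freely on `X` -/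
  free : ∀ (h : H) (x : X), h • x = x → h = 1
  exists_aut : ∃ x α, Φ x = Sum.inl α
  exists_hom : ∃ x f, Φ x = Sum.inr f
  /-- the homomorphisms in `B` have trivial common kernel -/
  ker_trivial : ∀ g : G, (∀ b ∈ msB Φ, b g = 1) → g = 1

end Multispinal

/-! ### GGS-groups -/

/-- The data of a GGS-group over the alphabet `ZMod m`: multispinal data in which `G = C` is
cyclic of order `m`, `H = ZMod m` acts on `X = ZMod m` by translation, `Φ(m-1)` is the identity
automorphism of `C` and `Φ(k)` is a homomorphism `C → ZMod m` for `0 ≤ k ≤ m - 2`. -/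
structure IsGGS {m : ℕ} {C : Type*} [Group C]
    (Φ : ZMod m → MulAut C ⊕ (C →* Multiplicative (ZMod m))) : Prop extends
    IsMultispinal Φ where
  cyclic : IsCyclic C
  card_eq : Nat.card C = m
  last : Φ ((m - 1 : ℕ) : ZMod m) = Sum.inl (MulEquiv.refl C)
  hom : ∀ k : ℕ, k + 2 ≤ m → ∃ f, Φ (k : ZMod m) = Sum.inr f

/-- The data of the Gupta-Sidki `p`-group, `p` an odd prime: `C` is cyclic of order `p` with
generator `t`, `Φ(p-1)` is the identity automorphism of `C`, and `Φ(0), ..., Φ(p-2)` are the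
homomorphisms `C → ZMod p` that send `t` to `1, -1, 0, ..., 0`. -/
structure IsGuptaSidki {p : ℕ} {C : Type*} [Group C] (t : C)
    (Φ : ZMod p → MulAut C ⊕ (C →* Multiplicative (ZMod p))) : Prop where
  prime : p.Prime
  ne_two : p ≠ 2
  gen : Subgroup.zpowers t = ⊤
  card_eq : Nat.card C = p
  last : Φ ((p - 1 : ℕ) : ZMod p) = Sum.inl (MulEquiv.refl C)
  zero : ∃ f, Φ 0 = Sum.inr f ∧ f t = Multiplicative.ofAdd 1
  one : ∃ f, Φ 1 = Sum.inr f ∧ f t = Multiplicative.ofAdd (-1)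
  rest : ∀ k : ℕ, 2 ≤ k → k + 2 ≤ p →
    ∃ f, Φ (k : ZMod p) = Sum.inr f ∧ f t = Multiplicative.ofAdd 0

/-!
Let `B` be the set of homomorphisms `f ∘ α` of a multispinal group and let `A ∈ K[G]`. If every
`b ∈ B` kills `A`, then `A` acts as zero on the free module over the infinite words: an infinite
word either leads the elements of `G` to some `f ∘ α`, or is fixed by all of them. If `A ≠ 0`, then
`A` does not vanish in the algebra, since it acts non-trivially once infinite words are paired with
germs of sections. So the representation on infinite words has a proper non-zero kernel.

Conversely, suppose that no non-zero `A ∈ K[G]` is killed by all `b ∈ B`. Multiplying a non-zero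
element of the algebra by words from both sides, and using that sections eventually lie in the
finite set of states, one reaches a non-zero combination of states, up to an error term that can be
removed by compressing further, from `a` to `r^* a r` for a suitable word `r`. A non-zero
combination of states is compressed to a non-zero scalar: states from `H` are separated at a letter
by the freeness of the action, and elements of `K[G]` are turned into elements of `K[H]` by a
`b ∈ B` that does not kill them.

If `G` is cyclic, then each non-injective homomorphism kills all elements of some prime order `p`,
and so kills the product in `K[G]` of the `1 - z_p`, where `z_p` has order `p`.
-/

/-! ### Self-similar actions -/

namespace SelfSimilarGroup

variable {X : Type*} (G : SelfSimilarGroup X)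

theorem exists_out_sec (g : G.carrier) (x : X) :
    ∃ p : X × G.carrier, ∀ w, g.1 (x :: w) = p.1 :: p.2.1 w := by
  obtain ⟨h, hh, hw⟩ := G.exists_section g.1 g.2 x
  obtain ⟨y, hy⟩ := List.length_eq_one_iff.1 (G.length_apply g.1 g.2 [x])
  exact ⟨(y, ⟨h, hh⟩), fun w => by rw [hw, hy, List.singleton_append]⟩

variable {G}

/-- The letter `g(x)`. -/
noncomputable def out (g : G.carrier) (x : X) : X := (G.exists_out_sec g x).choose.1

/-- The section `g|_x`. -/
noncomputable def sec (g : G.carrier) (x : X) : G.carrier := (G.exists_out_sec g x).choose.2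

theorem apply_cons (g : G.carrier) (x : X) (w : List X) : g.1 (x :: w) = out g x :: (sec g x).1 w :=
  (G.exists_out_sec g x).choose_spec w

theorem out_eq {g h : G.carrier} {x y : X} (hs : ∀ w, g.1 (x :: w) = y :: h.1 w) : out g x = y :=
  (List.cons.inj ((apply_cons g x []).symm.trans (hs []))).1

theorem sec_eq {g h : G.carrier} {x y : X} (hs : ∀ w, g.1 (x :: w) = y :: h.1 w) : sec g x = h :=
  Subtype.ext <| Equiv.ext fun w => (List.cons.inj ((apply_cons g x w).symm.trans (hs w))).2

theorem mul_apply_cons (g h : G.carrier) (x : X) (w : List X) :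
    (g * h).1 (x :: w) = out g (out h x) :: (sec g (out h x) * sec h x).1 w := by
  simp only [Subgroup.coe_mul, Equiv.Perm.mul_apply, apply_cons]

theorem out_mul (g h : G.carrier) (x : X) : out (g * h) x = out g (out h x) :=
  out_eq (mul_apply_cons g h x)

theorem sec_mul (g h : G.carrier) (x : X) : sec (g * h) x = sec g (out h x) * sec h x :=
  sec_eq (mul_apply_cons g h x)

@[simp]
theorem out_one (x : X) : out (1 : G.carrier) x = x := out_eq (h := 1) fun _ => rfl

@[simp]
theorem sec_one (x : X) : sec (1 : G.carrier) x = 1 := sec_eq (y := x) fun _ => rfl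

theorem out_inv_out (g : G.carrier) (x : X) : out g⁻¹ (out g x) = x := by
  rw [← out_mul, inv_mul_cancel, out_one]

theorem sec_inv_out (g : G.carrier) (x : X) : sec g⁻¹ (out g x) = (sec g x)⁻¹ := by
  rw [eq_inv_iff_mul_eq_one, ← sec_mul, inv_mul_cancel, sec_one]

/-- A `G`-set `Y` decomposed into copies `x Y` of itself indexed by the letters, on which `G` acts
by the same rule `g(xy) = g(x) g|_x(y)` as on words. Permutation representations of the
Nekrashevych algebra arise from such sets. -/
class SelfSimilarAction (G : SelfSimilarGroup X) (Y : Type*) extends MulAction G.carrier Y where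
  /-- the decomposition, as a bijection `(x, y) ↦ xy` -/
  cons : X × Y ≃ Y
  smul_cons (g : G.carrier) (x : X) (y : Y) : g • cons (x, y) = cons (out g x, sec g x • y)

/-- The section of `g` at the prefix of length `n` of an infinite word. -/
noncomputable def sectionAlong (g : G.carrier) (w : Stream' X) : ℕ → G.carrier
  | 0 => g
  | n + 1 => sec (sectionAlong g w n) (w n)

theorem sectionAlong_cons_succ (g : G.carrier) (x : X) (w : Stream' X) (n : ℕ) :
    sectionAlong g (w.cons x) (n + 1) = sectionAlong (sec g x) w n := by
  induction n with
  | zero => rfl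
  | succ n ih => exact congrArg (sec · (w n)) ih

noncomputable instance : SMul G.carrier (Stream' X) where
  smul g w n := out (sectionAlong g w n) (w n)

theorem smul_stream_apply (g : G.carrier) (w : Stream' X) (n : ℕ) :
    (g • w) n = out (sectionAlong g w n) (w n) := rfl

theorem sectionAlong_one (w : Stream' X) (n : ℕ) : sectionAlong (1 : G.carrier) w n = 1 := by
  induction n with
  | zero => rfl
  | succ n ih => rw [sectionAlong, ih, sec_one]

theorem sectionAlong_mul (g h : G.carrier) (w : Stream' X) (n : ℕ) :
    sectionAlong (g * h) w n = sectionAlong g (h • w) n * sectionAlong h w n := by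
  induction n with
  | zero => rfl
  | succ n ih => rw [sectionAlong, ih, sec_mul]; rfl

noncomputable instance streamAction : SelfSimilarAction G (Stream' X) where
  one_smul w := funext fun n => by rw [smul_stream_apply, sectionAlong_one, out_one]
  mul_smul g h w := funext fun n => by
    simp only [smul_stream_apply, sectionAlong_mul, out_mul]
  cons :=
    { toFun := fun p => p.2.cons p.1
      invFun := fun w => (w.head, w.tail)
      left_inv := fun _ => rfl
      right_inv := Stream'.eta }
  smul_cons g x w := by
    funext n
    cases n with
    | zero => rfl
    | succ n => exact congrArg (out · (w n)) (sectionAlong_cons_succ g x w n)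

open Filter

/-- The shift of germs at infinity of sequences, sending the germ of `u` to that of
`n ↦ u (n - 1)`. -/
def germShift (α : Type*) : (atTop : Filter ℕ).Germ α ≃ (atTop : Filter ℕ).Germ α where
  toFun l := l.compTendsto (· - 1) (tendsto_sub_atTop_nat 1)
  invFun l := l.compTendsto (· + 1) (tendsto_add_atTop_nat 1)
  left_inv l := l.inductionOn fun _ => rfl
  right_inv l := l.inductionOn fun u => Germ.coe_eq.2 <| by
    filter_upwards [eventually_ge_atTop 1] with n hn
    exact congrArg u (Nat.sub_add_cancel hn)

/-- An infinite word together with a germ at infinity of sequences of group elements. The group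
acts on the germ by its sections along the word, which tells apart group elements with the same
action on the word but different sections along its long prefixes. -/
structure GermPoint (G : SelfSimilarGroup X) where
  /-- the underlying infinite word -/
  stream : Stream' X
  /-- the germ -/
  germ : (atTop : Filter ℕ).Germ G.carrier

noncomputable instance : SMul G.carrier (GermPoint G) where
  smul g y := ⟨g • y.stream, (sectionAlong g y.stream : ℕ → G.carrier) * y.germ⟩

theorem smul_germPoint (g : G.carrier) (w : Stream' X) (l : (atTop : Filter ℕ).Germ G.carrier) :
    g • (⟨w, l⟩ : GermPoint G) = ⟨g • w, (sectionAlong g w : ℕ → G.carrier) * l⟩ := rfl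

theorem germShift_coe_sectionAlong (g : G.carrier) (x : X) (w : Stream' X) :
    germShift G.carrier (sectionAlong (sec g x) w : ℕ → G.carrier) =
      (sectionAlong g (w.cons x) : ℕ → G.carrier) :=
  Germ.coe_eq.2 <| by
    filter_upwards [eventually_ge_atTop 1] with n hn
    obtain ⟨k, rfl⟩ := Nat.exists_eq_add_of_le' hn
    exact (sectionAlong_cons_succ g x w k).symm

theorem germShift_mul (l₁ l₂ : (atTop : Filter ℕ).Germ G.carrier) :
    germShift G.carrier (l₁ * l₂) = germShift G.carrier l₁ * germShift G.carrier l₂ :=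
  Germ.inductionOn₂ l₁ l₂ fun _ _ => rfl

noncomputable instance germAction : SelfSimilarAction G (GermPoint G) where
  one_smul := fun ⟨w, l⟩ => by
    rw [smul_germPoint, one_smul, show sectionAlong (1 : G.carrier) w = 1 from
      funext (sectionAlong_one w), Germ.coe_one, one_mul]
  mul_smul g h := fun ⟨w, l⟩ => by
    simp only [smul_germPoint, mul_smul, ← mul_assoc, ← Germ.coe_mul]
    rw [show sectionAlong (g * h) w = _ from funext (sectionAlong_mul g h w)]
    rfl
  cons :=
    { toFun := fun p => ⟨p.2.stream.cons p.1, germShift _ p.2.germ⟩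
      invFun := fun y => (y.stream.head, ⟨y.stream.tail, (germShift _).symm y.germ⟩)
      left_inv := fun ⟨_, _⟩ => by simp
      right_inv := fun ⟨_, _⟩ => by simp }
  smul_cons g x := fun ⟨w, l⟩ => by
    simp only [Equiv.coe_fn_mk, smul_germPoint, germShift_mul, germShift_coe_sectionAlong]
    exact congrArg (GermPoint.mk · _) (streamAction.smul_cons g x w)

end SelfSimilarGroup

/-! ### The Nekrashevych algebra -/

namespace NekrashevychAlgebra

open SelfSimilarGroup

variable (K : Type*) [Field K] {X : Type*} (G : SelfSimilarGroup X)

section Representation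

variable (Y : Type*) [SelfSimilarAction G Y]

open Finsupp SelfSimilarAction

theorem cons_injective (x : X) : Function.Injective fun y : Y => cons G (x, y) :=
  fun _ _ h => (Prod.ext_iff.1 ((cons G).injective h)).2

/-- The operators on the free module `Y →₀ K` attached to the generators: `x` maps the basis
vector `y` to `xy`, its adjoint is the partial inverse, and `g` maps `y` to `g • y`. -/
noncomputable def repGen : NekGen G → Module.End K (Y →₀ K)
  | NekGen.letter x => lmapDomain K K fun y => cons G (x, y)
  | NekGen.adj x => lcomapDomain (fun y => cons G (x, y)) (cons_injective G Y x)
  | NekGen.grp g => lmapDomain K K (g • ·)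

theorem repGen_letter_single (x : X) (y : Y) (k : K) :
    repGen K G Y (.letter x) (single y k) = single (cons G (x, y)) k := mapDomain_single

theorem repGen_grp_single (g : G.carrier) (y : Y) (k : K) :
    repGen K G Y (.grp g) (single y k) = single (g • y) k := mapDomain_single

theorem repGen_adj_single_same (x : X) (y : Y) (k : K) :
    repGen K G Y (.adj x) (single (cons G (x, y)) k) = single y k :=
  comapDomain_single _ _ _ (cons_injective G Y x).injOn

theorem repGen_adj_single_ne {x x' : X} (h : x' ≠ x) (y : Y) (k : K) :
    repGen K G Y (.adj x') (single (cons G (x, y)) k) = 0 := by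
  ext z
  exact single_eq_of_ne fun e => h (Prod.ext_iff.1 ((cons G).injective e)).1

theorem repGen_rel [Fintype X] {a b : FreeAlgebra K (NekGen G)} (h : NekRel K G a b) :
    FreeAlgebra.lift K (repGen K G Y) a = FreeAlgebra.lift K (repGen K G Y) b := by
  refine lhom_ext' fun y => LinearMap.ext_ring ?_
  obtain ⟨⟨z, y⟩, rfl⟩ := (cons G).surjective y
  cases h with
  | grp_one => simp [nekG, repGen_grp_single]
  | grp_mul g h => simp [nekG, repGen_grp_single, mul_smul]
  | ss g h x z hs =>
    simp [nekG, nekX, repGen_grp_single, repGen_letter_single, smul_cons, out_eq hs, sec_eq hs]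
  | ss_adj g h x x' hs =>
    obtain rfl := out_eq hs
    obtain rfl := sec_eq hs
    by_cases hz : out g x = z
    · subst hz
      simp [nekG, nekXs, repGen_grp_single, repGen_adj_single_same, smul_cons, out_inv_out,
        sec_inv_out]
    · have hz' : x ≠ out g⁻¹ z := by
        rintro rfl
        exact hz (by rw [← out_mul, mul_inv_cancel, out_one])
      simp [nekG, nekXs, repGen_grp_single, repGen_adj_single_ne, smul_cons, hz, hz']
  | ck_same x => simp [nekX, nekXs, repGen_letter_single, repGen_adj_single_same]
  | ck_diff x x' hxx' => simp [nekX, nekXs, repGen_letter_single, repGen_adj_single_ne, hxx']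
  | ck_sum =>
    simp only [nekX, nekXs, map_sum, map_mul, FreeAlgebra.lift_ι_apply, LinearMap.coe_comp,
      Function.comp_apply, lsingle_apply, LinearMap.coe_sum, Finset.sum_apply, map_one,
      Module.End.mul_apply, Module.End.one_apply]
    rw [Finset.sum_eq_single z, repGen_adj_single_same, repGen_letter_single]
    · intro x _ hx
      rw [repGen_adj_single_ne K G Y hx, map_zero]
    · exact fun h => absurd (Finset.mem_univ z) h

end Representation

variable [Fintype X]

/-- The quotient map from the free algebra. -/
noncomputable def mk : FreeAlgebra K (NekGen G) →ₐ[K] NekrashevychAlgebra K G :=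
  RingQuot.mkAlgHom K (NekRel K G)

/-- The letter `x` in the Nekrashevych algebra. -/
noncomputable def letter (x : X) : NekrashevychAlgebra K G := mk K G (nekX K G x)

/-- The adjoint of the letter `x` in the Nekrashevych algebra. -/
noncomputable def adj (x : X) : NekrashevychAlgebra K G := mk K G (nekXs K G x)

/-- The map from the group to the Nekrashevych algebra. -/
noncomputable def grp : G.carrier →* NekrashevychAlgebra K G where
  toFun g := mk K G (nekG K G g)
  map_one' := (RingQuot.mkAlgHom_rel K NekRel.grp_one).trans (map_one _)
  map_mul' g h := (RingQuot.mkAlgHom_rel K (NekRel.grp_mul g h)).symm.trans (map_mul _ _ _)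

theorem grp_mul_letter (g : G.carrier) (x : X) :
    grp K G g * letter K G x = letter K G (out g x) * grp K G (sec g x) := by
  have := RingQuot.mkAlgHom_rel K (NekRel.ss (K := K) g _ x _ (apply_cons g x))
  rwa [map_mul, map_mul] at this

theorem adj_mul_letter_same (x : X) : adj K G x * letter K G x = 1 := by
  have := RingQuot.mkAlgHom_rel K (NekRel.ck_same (K := K) (G := G) x)
  rwa [map_mul, map_one] at this

theorem adj_mul_letter_ne {x y : X} (h : y ≠ x) : adj K G y * letter K G x = 0 := by
  have := RingQuot.mkAlgHom_rel K (NekRel.ck_diff (K := K) (G := G) x y h)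
  rwa [map_mul, map_zero] at this

theorem sum_letter_mul_adj : ∑ x, letter K G x * adj K G x = 1 := by
  have := RingQuot.mkAlgHom_rel K (NekRel.ck_sum (K := K) (G := G))
  rw [map_sum, map_one] at this
  simp only [map_mul] at this
  exact this

theorem induction_left {P : NekrashevychAlgebra K G → Prop} (one : P 1)
    (add : ∀ a b, P a → P b → P (a + b)) (smul : ∀ (k : K) a, P a → P (k • a))
    (letter_mul : ∀ x a, P a → P (letter K G x * a)) (adj_mul : ∀ x a, P a → P (adj K G x * a))
    (grp_mul : ∀ g a, P a → P (grp K G g * a)) (a : NekrashevychAlgebra K G) : P a := by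
  suffices H : ∀ f : FreeAlgebra K (NekGen G), ∀ a, P a → P (mk K G f * a) by
    obtain ⟨f, rfl⟩ := RingQuot.mkAlgHom_surjective K (NekRel K G) a
    have := H f 1 one
    rwa [mul_one] at this
  intro f
  induction f using FreeAlgebra.induction with
  | grade0 k =>
    intro a ha
    rw [AlgHom.commutes, ← Algebra.smul_def]
    exact smul k a ha
  | grade1 x =>
    cases x with
    | letter x => exact letter_mul x
    | adj x => exact adj_mul x
    | grp g => exact grp_mul g
  | mul f g hf hg =>
    intro a ha
    rw [map_mul, mul_assoc]
    exact hf _ (hg _ ha)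
  | add f g hf hg =>
    intro a ha
    rw [map_add, add_mul]
    exact add _ _ (hf _ ha) (hg _ ha)

section Representation

variable (Y : Type*) [SelfSimilarAction G Y]

/-- The permutation representation of the Nekrashevych algebra on the free module with basis `Y`. -/
noncomputable def rep : NekrashevychAlgebra K G →ₐ[K] Module.End K (Y →₀ K) :=
  RingQuot.liftAlgHom K ⟨FreeAlgebra.lift K (repGen K G Y), fun _ _ h => repGen_rel K G Y h⟩

theorem rep_grp_single (g : G.carrier) (y : Y) (k : K) :
    rep K G Y (grp K G g) (Finsupp.single y k) = Finsupp.single (g • y) k := by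
  rw [← repGen_grp_single]
  simp [rep, grp, mk, nekG]

end Representation

instance [Nonempty X] : Nontrivial (NekrashevychAlgebra K G) :=
  have : Nonempty (Stream' X) := ⟨fun _ => Classical.arbitrary X⟩
  (rep K G (Stream' X)).toRingHom.domain_nontrivial

/-- The product of the letters of a word. -/
noncomputable def word (u : List X) : NekrashevychAlgebra K G := (u.map (letter K G)).prod

/-- The adjoint of `word u`, the product of the adjoints of the letters in reverse order. -/
noncomputable def wordAdj (u : List X) : NekrashevychAlgebra K G := (u.map (adj K G)).reverse.prod

@[simp]
theorem word_nil : word K G [] = 1 := rfl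

@[simp]
theorem wordAdj_nil : wordAdj K G [] = 1 := rfl

theorem word_cons (x : X) (u : List X) : word K G (x :: u) = letter K G x * word K G u := by
  simp [word]

theorem word_singleton (x : X) : word K G [x] = letter K G x := by
  simp [word]

theorem word_append (u v : List X) : word K G (u ++ v) = word K G u * word K G v := by
  simp [word]

theorem wordAdj_cons (x : X) (u : List X) : wordAdj K G (x :: u) = wordAdj K G u * adj K G x := by
  simp [wordAdj]

theorem wordAdj_singleton (x : X) : wordAdj K G [x] = adj K G x := by
  simp [wordAdj]

theorem wordAdj_append (u v : List X) :
    wordAdj K G (u ++ v) = wordAdj K G v * wordAdj K G u := by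
  simp [wordAdj]

theorem wordAdj_mul_word_append (u v : List X) :
    wordAdj K G u * word K G (u ++ v) = word K G v := by
  induction u with
  | nil => simp
  | cons x u ih =>
    rw [wordAdj_cons, List.cons_append, word_cons, mul_assoc, ← mul_assoc (adj K G x),
      adj_mul_letter_same, one_mul, ih]

theorem wordAdj_mul_word_self (u : List X) : wordAdj K G u * word K G u = 1 := by
  simpa using wordAdj_mul_word_append K G u []

variable {K G}

theorem wordAdj_mul_word_eq_zero {u v : List X} (hl : u.length ≤ v.length) (h : ¬ u <+: v) :
    wordAdj K G u * word K G v = 0 := by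
  induction u generalizing v with
  | nil => exact absurd List.nil_prefix h
  | cons x u ih =>
    cases v with
    | nil => simp at hl
    | cons y v =>
      rw [wordAdj_cons, word_cons, mul_assoc, ← mul_assoc (adj K G x)]
      by_cases hxy : x = y
      · subst hxy
        rw [adj_mul_letter_same, one_mul]
        exact ih (Nat.le_of_succ_le_succ hl) fun h' => h (List.cons_prefix_cons.2 ⟨rfl, h'⟩)
      · rw [adj_mul_letter_ne K G hxy, zero_mul, mul_zero]

theorem exists_mul_letter_ne_zero {a : NekrashevychAlgebra K G} (ha : a ≠ 0) :
    ∃ x, a * letter K G x ≠ 0 := by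
  contrapose! ha
  rw [← mul_one a, ← sum_letter_mul_adj, Finset.mul_sum]
  exact Finset.sum_eq_zero fun x _ => by rw [← mul_assoc, ha, zero_mul]

theorem exists_adj_mul_ne_zero {a : NekrashevychAlgebra K G} (ha : a ≠ 0) :
    ∃ x, adj K G x * a ≠ 0 := by
  contrapose! ha
  rw [← one_mul a, ← sum_letter_mul_adj, Finset.sum_mul]
  exact Finset.sum_eq_zero fun x _ => by rw [mul_assoc, ha, mul_zero]

theorem exists_mul_word_ne_zero {a : NekrashevychAlgebra K G} (ha : a ≠ 0) (n : ℕ) :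
    ∃ v : List X, v.length = n ∧ a * word K G v ≠ 0 := by
  induction n generalizing a with
  | zero => exact ⟨[], rfl, by rwa [word_nil, mul_one]⟩
  | succ n ih =>
    obtain ⟨x, hx⟩ := exists_mul_letter_ne_zero ha
    obtain ⟨v, hv, hav⟩ := ih hx
    exact ⟨x :: v, congrArg Nat.succ hv, by rwa [word_cons, ← mul_assoc]⟩

end NekrashevychAlgebra

/-! ### Multispinal groups -/

namespace multispinalGroup

open SelfSimilarGroup NekrashevychAlgebra

variable {G H X : Type*} [Group G] [Group H]

section Automaton

variable {Φ : X → MulAut G ⊕ (G →* H)}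

theorem msNext_inl_of_eq_inl {x : X} {α : MulAut G} (h : Φ x = Sum.inl α) (c : G) :
    msNext Φ (Sum.inl c) x = Sum.inl (α c) := by
  simp only [msNext, h]

theorem msNext_inl_of_eq_inr {x : X} {f : G →* H} (h : Φ x = Sum.inr f) (c : G) :
    msNext Φ (Sum.inl c) x = Sum.inr (f c) := by
  simp only [msNext, h]

theorem msNext_inr (h : H) (x : X) : msNext Φ (Sum.inr h) x = Sum.inr 1 := rfl

variable [MulAction H X]

theorem msAct_append (s : G ⊕ H) (u v : List X) :
    msAct Φ s (u ++ v) = msAct Φ s u ++ msAct Φ (u.foldl (msNext Φ) s) v := by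
  induction u generalizing s with
  | nil => rfl
  | cons x u ih => simp only [List.cons_append, msAct, ih, List.foldl_cons]

theorem msAct_inr_one (w : List X) : msAct Φ (Sum.inr 1) w = w := by
  induction w with
  | nil => rfl
  | cons x w ih => simp only [msAct, msOut, msNext, one_smul, ih]

theorem msAct_inr_mul (h k : H) (w : List X) :
    msAct Φ (Sum.inr (h * k)) w = msAct Φ (Sum.inr h) (msAct Φ (Sum.inr k) w) := by
  cases w with
  | nil => rfl
  | cons x w => simp only [msAct, msOut, msNext, mul_smul, msAct_inr_one]

theorem msAct_inl_mul (c d : G) (w : List X) :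
    msAct Φ (Sum.inl (c * d)) w = msAct Φ (Sum.inl c) (msAct Φ (Sum.inl d) w) := by
  induction w generalizing c d with
  | nil => rfl
  | cons x w ih =>
    rcases hx : Φ x with α | f
    · simp only [msAct, msOut, msNext_inl_of_eq_inl hx, map_mul, ih]
    · simp only [msAct, msOut, msNext_inl_of_eq_inr hx, map_mul, msAct_inr_mul]

theorem exists_msAct_inl_replicate_append {z : X} {α : MulAut G} (hz : Φ z = Sum.inl α) (c : G)
    (k : ℕ) (w : List X) :
    ∃ v, msAct Φ (Sum.inl c) (List.replicate k z ++ w) = List.replicate k z ++ v := by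
  induction k generalizing c with
  | zero => exact ⟨_, rfl⟩
  | succ k ih =>
    obtain ⟨v, hv⟩ := ih (α c)
    refine ⟨v, ?_⟩
    simp only [List.replicate_succ, List.cons_append, msAct, msOut, msNext_inl_of_eq_inl hz, hv]

theorem exists_msAct_replicate_succ_append {z : X} {α : MulAut G} (hz : Φ z = Sum.inl α)
    (s : G ⊕ H) (k : ℕ) (w : List X) :
    ∃ y v, msAct Φ s (List.replicate (k + 1) z ++ w) = y :: (List.replicate k z ++ v) := by
  rcases s with c | h
  · obtain ⟨v, hv⟩ := exists_msAct_inl_replicate_append hz c (k + 1) w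
    exact ⟨z, v, hv⟩
  · exact ⟨h • z, w, congrArg (h • z :: ·) (msAct_inr_one _)⟩

/-- At a letter `z ≠ y` the action of any state on `z ⋯ z y` changes at most the first `z` and the
last `y`, so that prepending a nonempty word destroys the occurrence of `y` after `k` copies of
`z`. -/
theorem not_isPrefix_append_msAct {z y : X} (hzy : y ≠ z) {α : MulAut G} (hz : Φ z = Sum.inl α)
    {u : List X} (hu : u ≠ []) {k : ℕ} (hk : u.length < k) (s : G ⊕ H) :
    ¬ List.replicate k z ++ [y] <+: u ++ msAct Φ s (List.replicate k z ++ [y]) := by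
  obtain ⟨k, rfl⟩ := Nat.exists_eq_add_of_le' (Nat.one_le_of_lt hk)
  obtain ⟨x, v, hv⟩ := exists_msAct_replicate_succ_append hz s k [y]
  intro h
  have hy := List.prefix_iff_getElem?.1 h (k + 1) (by simp)
  have hu0 := List.length_pos_of_ne_nil hu
  obtain ⟨j, hj⟩ : ∃ j, k + 1 - u.length = j + 1 := ⟨k - u.length, by lia⟩
  rw [hv, List.getElem?_append_right (by lia), hj, List.getElem?_cons_succ,
    List.getElem?_append_left (by simp; lia)] at hy
  exact hzy (by simpa [List.getElem?_replicate, show j < k by lia] using hy.symm)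

end Automaton

section States

variable [MulAction H X] (Φ : X → MulAut G ⊕ (G →* H))

theorem msPerm_inv (s : G ⊕ H) : (msPerm Φ s)⁻¹ = msPerm Φ (msInv s) := Equiv.ext fun _ => rfl

/-- A state of the automaton as an element of the multispinal group. -/
def msElem (s : G ⊕ H) : (multispinalGroup Φ).carrier :=
  ⟨msPerm Φ s, Subgroup.subset_closure ⟨s, rfl⟩⟩

theorem msElem_apply_cons (s : G ⊕ H) (x : X) (w : List X) :
    (msElem Φ s).1 (x :: w) = msOut s x :: (msElem Φ (msNext Φ s x)).1 w := rfl

theorem out_msElem (s : G ⊕ H) (x : X) : out (msElem Φ s) x = msOut s x :=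
  out_eq (msElem_apply_cons Φ s x)

theorem sec_msElem (s : G ⊕ H) (x : X) : sec (msElem Φ s) x = msElem Φ (msNext Φ s x) :=
  sec_eq (msElem_apply_cons Φ s x)

theorem msElem_inr_one : msElem Φ (Sum.inr 1 : G ⊕ H) = 1 :=
  Subtype.ext <| Equiv.ext msAct_inr_one

/-- The states from `G` as a homomorphism to the multispinal group. -/
def inlHom : G →* (multispinalGroup Φ).carrier :=
  MonoidHom.mk' (fun c => msElem Φ (Sum.inl c)) fun c d =>
    Subtype.ext <| Equiv.ext <| msAct_inl_mul c d

theorem inlHom_apply (c : G) : inlHom Φ c = msElem Φ (Sum.inl c) := rfl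

variable {Φ} in
theorem carrier_induction {p : (multispinalGroup Φ).carrier → Prop} (one : p 1)
    (mul : ∀ g h, p g → p h → p (g * h)) (state : ∀ s, p (msElem Φ s))
    (g : (multispinalGroup Φ).carrier) : p g := by
  obtain ⟨g, hg⟩ := g
  induction hg using Subgroup.closure_induction'' with
  | mem g hg =>
    obtain ⟨s, rfl⟩ := hg
    exact state s
  | inv_mem g hg =>
    obtain ⟨s, rfl⟩ := hg
    simp only [msPerm_inv]
    exact state (msInv s)
  | one => exact one
  | mul g h hg hh ihg ihh => exact mul ⟨g, hg⟩ ⟨h, hh⟩ ihg ihh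

end States

section Corner

variable {Φ : X → MulAut G ⊕ (G →* H)} [MulAction H X]

theorem exists_word_of_mem_msA [Finite G] {α : MulAut G} (hα : α ∈ msA Φ) :
    ∃ v : List X, ∀ c, v.foldl (msNext Φ) (Sum.inl c) = Sum.inl (α c) ∧
      msAct Φ (Sum.inl c) v = v := by
  have : Finite (MulAut G) := Finite.of_injective _ MulEquiv.toEquiv_injective
  rw [msA, ← Subgroup.mem_toSubmonoid, Subgroup.closure_toSubmonoid_of_finite] at hα
  induction hα using Submonoid.closure_induction with
  | mem α hα =>
    obtain ⟨x, hx⟩ := hα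
    exact ⟨[x], fun c => ⟨msNext_inl_of_eq_inl hx c, rfl⟩⟩
  | one => exact ⟨[], fun c => ⟨rfl, rfl⟩⟩
  | mul α β _ _ ihα ihβ =>
    obtain ⟨u, hu⟩ := ihα
    obtain ⟨v, hv⟩ := ihβ
    refine ⟨v ++ u, fun c => ⟨?_, ?_⟩⟩
    · rw [List.foldl_append, (hv c).1, (hu _).1, MulAut.mul_apply]
    · rw [msAct_append, (hv c).1, (hv c).2, (hu _).2]

theorem exists_word_of_mem_msB [Finite G] {b : G →* H} (hb : b ∈ msB Φ) :
    ∃ v : List X, ∀ c, v.foldl (msNext Φ) (Sum.inl c) = Sum.inr (b c) ∧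
      msAct Φ (Sum.inl c) v = v := by
  obtain ⟨f, ⟨x, hx⟩, α, hα, rfl⟩ := hb
  obtain ⟨v, hv⟩ := exists_word_of_mem_msA hα
  refine ⟨v ++ [x], fun c => ⟨?_, ?_⟩⟩
  · rw [List.foldl_append, (hv c).1]
    exact msNext_inl_of_eq_inr hx (α c)
  · rw [msAct_append, (hv c).1, (hv c).2]
    rfl

end Corner

end multispinalGroup

namespace IsMultispinal

open multispinalGroup

variable {G H X : Type*} [Group G] [Group H] [MulAction H X] {Φ : X → MulAut G ⊕ (G →* H)}

theorem eq_of_smul_eq_smul (hΦ : IsMultispinal Φ) {h k : H} {x : X} (hx : h • x = k • x) :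
    h = k :=
  (inv_mul_eq_one.1 (hΦ.free (k⁻¹ * h) x (by rw [mul_smul, hx, inv_smul_smul]))).symm

theorem inlHom_injective (hΦ : IsMultispinal Φ) : Function.Injective (inlHom Φ) := by
  have := hΦ.finite_left
  obtain ⟨x, -, -⟩ := hΦ.exists_aut
  refine (injective_iff_map_eq_one _).2 fun c hc => hΦ.ker_trivial c fun b hb => ?_
  obtain ⟨v, hv⟩ := exists_word_of_mem_msB hb
  have hvx : msAct Φ (Sum.inl c) (v ++ [x]) = v ++ [x] :=
    DFunLike.congr_fun (congrArg Subtype.val hc) (v ++ [x])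
  rw [msAct_append, (hv c).1, (hv c).2] at hvx
  exact hΦ.free (b c) x (List.cons.inj (List.append_cancel_left hvx)).1

end IsMultispinal

/-! ### The simplicity criterion -/

theorem isSimpleRing_of_exists_mul_mul_eq_one {R : Type*} [Ring R] [Nontrivial R]
    (h : ∀ a : R, a ≠ 0 → ∃ c d, c * a * d = 1) : IsSimpleRing R :=
  IsSimpleRing.of_eq_bot_or_eq_top fun I => or_iff_not_imp_left.2 fun hI => by
    obtain ⟨a, ha, ha0⟩ : ∃ a ∈ I, a ≠ 0 := by
      contrapose! hI
      exact eq_bot_iff.2 fun a ha => hI a ha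
    obtain ⟨c, d, hcd⟩ := h a ha0
    exact I.one_mem_iff.1 (hcd ▸ I.mul_mem_right _ _ (I.mul_mem_left _ _ ha))

namespace multispinalGroup

open SelfSimilarGroup NekrashevychAlgebra

variable (K : Type*) [Field K] {G H X : Type*} [Group G] [Group H] [MulAction H X] [Fintype X]
  (Φ : X → MulAut G ⊕ (G →* H))

local notation "𝒩" => NekrashevychAlgebra K (multispinalGroup Φ)

/-- A state of the automaton as an element of the Nekrashevych algebra. -/
noncomputable def state (s : G ⊕ H) : 𝒩 := grp K (multispinalGroup Φ) (msElem Φ s)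

theorem state_inr_one : state K Φ (Sum.inr 1) = 1 := by
  rw [state, msElem_inr_one, map_one]

theorem state_inl_one : state K Φ (Sum.inl 1) = 1 := by
  rw [state, ← inlHom_apply, map_one, map_one]

theorem state_inl_mul (c d : G) :
    state K Φ (Sum.inl (c * d)) = state K Φ (Sum.inl c) * state K Φ (Sum.inl d) := by
  simp only [state, ← inlHom_apply, map_mul]

theorem state_mul_letter (s : G ⊕ H) (x : X) :
    state K Φ s * letter K _ x = letter K _ (msOut s x) * state K Φ (msNext Φ s x) := by
  rw [state, grp_mul_letter, out_msElem, sec_msElem, state]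

theorem state_mul_word (s : G ⊕ H) (u : List X) :
    state K Φ s * word K _ u = word K _ (msAct Φ s u) * state K Φ (u.foldl (msNext Φ) s) := by
  induction u generalizing s with
  | nil => simp [msAct]
  | cons x u ih =>
    rw [word_cons, ← mul_assoc, state_mul_letter, mul_assoc, ih, ← mul_assoc, ← word_cons]
    rfl

theorem exists_state_mul_state_mul_letter (s t : G ⊕ H) (x : X) :
    ∃ y r, state K Φ s * state K Φ t * letter K _ x = letter K _ y * state K Φ r := by
  rcases s with c | h
  · rcases t with d | h
    · exact ⟨_, _, by rw [← state_inl_mul, state_mul_letter]⟩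
    · refine ⟨h • x, msNext Φ (Sum.inl c) (h • x), ?_⟩
      rw [mul_assoc, state_mul_letter, msNext_inr, state_inr_one, mul_one, msOut, state_mul_letter,
        msOut]
  · refine ⟨h • msOut t x, msNext Φ t x, ?_⟩
    rw [mul_assoc, state_mul_letter, ← mul_assoc, state_mul_letter, msNext_inr, state_inr_one,
      mul_one, msOut]

/-- The linear span of the elements `u s` of the Nekrashevych algebra, with `u` a word in `W` and
`s` a state of the automaton. -/
noncomputable def wordStateSpan (W : Set (List X)) : Submodule K 𝒩 :=
  Submodule.span K (Set.image2 (fun u s => word K _ u * state K Φ s) W Set.univ)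

variable {K Φ}

theorem word_mul_state_mem {W : Set (List X)} {u : List X} (hu : u ∈ W) (s : G ⊕ H) :
    word K _ u * state K Φ s ∈ wordStateSpan K Φ W :=
  Submodule.subset_span ⟨u, hu, s, trivial, rfl⟩

theorem word_mem {W : Set (List X)} {u : List X} (hu : u ∈ W) :
    word K _ u ∈ wordStateSpan K Φ W := by
  simpa only [state_inr_one, mul_one] using word_mul_state_mem (K := K) (Φ := Φ) hu (Sum.inr 1)

theorem wordStateSpan_mono {V W : Set (List X)} (h : V ⊆ W) :
    wordStateSpan K Φ V ≤ wordStateSpan K Φ W :=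
  Submodule.span_mono (Set.image2_subset_right h)

theorem wordStateSpan_union (V W : Set (List X)) :
    wordStateSpan K Φ (V ∪ W) = wordStateSpan K Φ V ⊔ wordStateSpan K Φ W := by
  rw [wordStateSpan, Set.image2_union_left, Submodule.span_union]
  rfl

theorem mul_mul_mem_of_mem_wordStateSpan {W : Set (List X)} {N : Submodule K 𝒩} {c d : 𝒩}
    (h : ∀ u ∈ W, ∀ s, c * (word K _ u * state K Φ s) * d ∈ N) {a : 𝒩}
    (ha : a ∈ wordStateSpan K Φ W) : c * a * d ∈ N := by
  refine (Submodule.span_le (p := N.comap (LinearMap.mulLeftRight K (c, d)))).2 ?_ ha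
  rintro _ ⟨u, hu, s, -, rfl⟩
  exact h u hu s

theorem word_mul_state_mul_letter (u : List X) (s : G ⊕ H) (x : X) :
    word K _ u * state K Φ s * letter K _ x =
      word K _ (u ++ [msOut s x]) * state K Φ (msNext Φ s x) := by
  rw [mul_assoc, state_mul_letter, ← mul_assoc, word_append, word_singleton]

theorem letter_mul_mul_letter_mem {a : 𝒩} (ha : a ∈ wordStateSpan K Φ Set.univ) (x y : X) :
    letter K _ x * a * letter K _ y ∈ wordStateSpan K Φ Set.univ := by
  refine mul_mul_mem_of_mem_wordStateSpan (fun u _ s => ?_) ha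
  rw [← mul_assoc, ← word_cons, word_mul_state_mul_letter]
  exact word_mul_state_mem (Set.mem_univ _) _

theorem adj_mul_mul_letter_mem {a : 𝒩} (ha : a ∈ wordStateSpan K Φ Set.univ) (x y : X) :
    adj K _ x * a * letter K _ y ∈ wordStateSpan K Φ Set.univ := by
  refine mul_mul_mem_of_mem_wordStateSpan (fun u _ s => ?_) ha
  rw [mul_assoc, word_mul_state_mul_letter, ← mul_assoc]
  obtain ⟨z, v, hv⟩ := List.exists_cons_of_ne_nil (List.append_ne_nil_of_right_ne_nil u
    (List.cons_ne_nil (msOut s y) []))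
  rw [hv, word_cons, ← mul_assoc]
  by_cases hxz : x = z
  · rw [hxz, adj_mul_letter_same, one_mul]
    exact word_mul_state_mem (Set.mem_univ _) _
  · rw [adj_mul_letter_ne K _ hxz, zero_mul, zero_mul]
    exact zero_mem _

theorem state_mul_mul_letter_mem {a : 𝒩} (ha : a ∈ wordStateSpan K Φ Set.univ) (t : G ⊕ H) (y : X) :
    state K Φ t * a * letter K _ y ∈ wordStateSpan K Φ Set.univ := by
  refine mul_mul_mem_of_mem_wordStateSpan (fun u _ s => ?_) ha
  obtain ⟨z, r, hr⟩ := exists_state_mul_state_mul_letter K Φ (u.foldl (msNext Φ) t) s y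
  have : state K Φ t * (word K _ u * state K Φ s) * letter K _ y =
      word K _ (msAct Φ t u ++ [z]) * state K Φ r := by
    rw [← mul_assoc, state_mul_word, mul_assoc, mul_assoc, ← mul_assoc (state K Φ _), hr,
      ← mul_assoc, word_append, word_singleton]
  exact this ▸ word_mul_state_mem (Set.mem_univ _) _

variable (K Φ) in
/-- The elements of the algebra that are mapped into `wordStateSpan` by right multiplication with
all sufficiently long words. -/
def contracted : Submodule K 𝒩 where
  carrier := {a | ∃ n, ∀ v : List X, n ≤ v.length → a * word K _ v ∈ wordStateSpan K Φ Set.univ}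
  add_mem' := by
    rintro a b ⟨m, hm⟩ ⟨n, hn⟩
    refine ⟨max m n, fun v hv => ?_⟩
    rw [add_mul]
    exact add_mem (hm v (le_trans (le_max_left m n) hv)) (hn v (le_trans (le_max_right m n) hv))
  zero_mem' := ⟨0, fun v _ => by rw [zero_mul]; exact zero_mem _⟩
  smul_mem' := by
    rintro k a ⟨n, hn⟩
    exact ⟨n, fun v hv => by rw [smul_mul_assoc]; exact Submodule.smul_mem _ k (hn v hv)⟩

theorem mul_mem_contracted {c : 𝒩}
    (hc : ∀ a ∈ wordStateSpan K Φ Set.univ, ∀ y,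
      c * a * letter K _ y ∈ wordStateSpan K Φ Set.univ) {a : 𝒩} (ha : a ∈ contracted K Φ) :
    c * a ∈ contracted K Φ := by
  obtain ⟨n, hn⟩ := ha
  refine ⟨n + 1, fun v hv => ?_⟩
  obtain ⟨u, y, rfl⟩ :=
    (List.eq_nil_or_concat' v).resolve_left (List.ne_nil_of_length_pos (by lia))
  rw [word_append, word_singleton, ← mul_assoc, mul_assoc c]
  exact hc _ (hn u (by simpa using hv)) y

theorem mem_contracted (a : 𝒩) : a ∈ contracted K Φ := by
  induction a using induction_left with
  | one => exact ⟨0, fun v _ => by rw [one_mul]; exact word_mem (Set.mem_univ v)⟩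
  | add a b ha hb => exact add_mem ha hb
  | smul k a ha => exact Submodule.smul_mem _ k ha
  | letter_mul x a ha => exact mul_mem_contracted (fun b hb => letter_mul_mul_letter_mem hb x) ha
  | adj_mul x a ha => exact mul_mem_contracted (fun b hb => adj_mul_mul_letter_mem hb x) ha
  | grp_mul g a ha =>
    induction g using carrier_induction generalizing a with
    | one => rwa [map_one, one_mul]
    | mul g h ihg ihh =>
      rw [map_mul, mul_assoc]
      exact ihg _ (ihh _ ha)
    | state s => exact mul_mem_contracted (fun b hb => state_mul_mul_letter_mem hb s) ha

theorem exists_mul_word_mem_wordStateSpan {a : 𝒩} (ha : a ≠ 0) :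
    ∃ v, a * word K _ v ∈ wordStateSpan K Φ Set.univ ∧ a * word K _ v ≠ 0 := by
  obtain ⟨n, hn⟩ := mem_contracted a
  obtain ⟨v, hv, hav⟩ := exists_mul_word_ne_zero ha n
  exact ⟨v, hn v hv.ge, hav⟩

theorem mem_wordStateSpan_nil {a : 𝒩} :
    a ∈ wordStateSpan K Φ {[]} ↔ ∃ C, Finsupp.linearCombination K (state K Φ) C = a := by
  simp only [wordStateSpan, Set.image2_singleton_left, word_nil, one_mul, Set.image_univ,
    ← Finsupp.range_linearCombination, LinearMap.mem_range]

theorem exists_mem_wordStateSpan_length_le {a : 𝒩} (ha : a ∈ wordStateSpan K Φ Set.univ) :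
    ∃ n, a ∈ wordStateSpan K Φ {u | u.length ≤ n} := by
  induction ha using Submodule.span_induction with
  | mem a ha =>
    obtain ⟨u, -, s, -, rfl⟩ := ha
    exact ⟨u.length, word_mul_state_mem (le_refl u.length) s⟩
  | zero => exact ⟨0, zero_mem _⟩
  | add a b _ _ iha ihb =>
    obtain ⟨m, hm⟩ := iha
    obtain ⟨n, hn⟩ := ihb
    exact ⟨max m n, add_mem (wordStateSpan_mono (fun u hu => le_trans hu (le_max_left m n)) hm)
      (wordStateSpan_mono (fun u hu => le_trans hu (le_max_right m n)) hn)⟩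
  | smul k a _ iha =>
    obtain ⟨n, hn⟩ := iha
    exact ⟨n, Submodule.smul_mem _ k hn⟩

theorem adj_mul_mem_wordStateSpan_length_le {n : ℕ} {a : 𝒩}
    (ha : a ∈ wordStateSpan K Φ {u | u ≠ [] ∧ u.length ≤ n + 1}) (x : X) :
    adj K _ x * a ∈ wordStateSpan K Φ {u | u.length ≤ n} := by
  rw [← mul_one (adj K _ x * a)]
  refine mul_mul_mem_of_mem_wordStateSpan (fun u hu s => ?_) ha
  obtain ⟨hu, hun⟩ := hu
  obtain ⟨y, v, rfl⟩ := List.exists_cons_of_ne_nil hu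
  rw [mul_one, word_cons, mul_assoc, ← mul_assoc]
  by_cases hxy : x = y
  · rw [hxy, adj_mul_letter_same, one_mul]
    exact word_mul_state_mem (Nat.le_of_succ_le_succ hun) s
  · rw [adj_mul_letter_ne K _ hxy, zero_mul]
    exact zero_mem _

theorem exists_wordAdj_mul_eq_add {n : ℕ} {a : 𝒩}
    (ha : a ∈ wordStateSpan K Φ {u | u.length ≤ n}) (ha0 : a ≠ 0) :
    ∃ v, ∃ s ∈ wordStateSpan K Φ {[]}, s ≠ 0 ∧ ∃ b ∈ wordStateSpan K Φ {u | u ≠ []},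
      wordAdj K _ v * a = s + b := by
  induction n generalizing a with
  | zero =>
    refine ⟨[], a, wordStateSpan_mono (fun u hu => ?_) ha, ha0, 0, zero_mem _, by simp⟩
    exact List.length_eq_zero_iff.1 (Nat.le_zero.1 hu)
  | succ n ih =>
    have hsplit : {u : List X | u.length ≤ n + 1} ⊆ {[]} ∪ {u | u ≠ [] ∧ u.length ≤ n + 1} :=
      fun u hu => (eq_or_ne u []).imp_right fun h => ⟨h, hu⟩
    have ha' := wordStateSpan_mono hsplit ha
    rw [wordStateSpan_union] at ha'
    obtain ⟨s, hs, b, hb, rfl⟩ := Submodule.mem_sup.1 ha'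
    rcases eq_or_ne s 0 with rfl | hs0
    · rw [zero_add] at ha0 ⊢
      obtain ⟨x, hx⟩ := exists_adj_mul_ne_zero ha0
      obtain ⟨v, t, ht, ht0, c, hc, h⟩ := ih (adj_mul_mem_wordStateSpan_length_le hb x) hx
      exact ⟨x :: v, t, ht, ht0, c, hc, by rw [wordAdj_cons, mul_assoc, h]⟩
    · exact ⟨[], s, hs, hs0, b, wordStateSpan_mono (fun u hu => hu.1) hb, by simp⟩

theorem wordAdj_mul_mul_word_mem {p q : List X} (hpq : p.length = q.length) {a : 𝒩}
    (ha : a ∈ wordStateSpan K Φ {u | u ≠ []}) :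
    wordAdj K _ p * a * word K _ q ∈ wordStateSpan K Φ {u | u ≠ []} := by
  refine mul_mul_mem_of_mem_wordStateSpan (fun u hu s => ?_) ha
  have hlt : p.length < (u ++ msAct Φ s q).length := by
    have := List.length_pos_of_ne_nil hu
    rw [List.length_append, length_msAct]
    lia
  rw [mul_assoc, mul_assoc, state_mul_word, ← mul_assoc (word K _ u), ← word_append, ← mul_assoc]
  by_cases hp : p <+: u ++ msAct Φ s q
  · obtain ⟨t, ht⟩ := hp
    rw [← ht, wordAdj_mul_word_append]
    refine word_mul_state_mem ?_ _
    rintro rfl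
    rw [← ht, List.append_nil] at hlt
    exact hlt.false
  · rw [wordAdj_mul_word_eq_zero hlt.le hp, zero_mul]
    exact zero_mem _

open Filter in
theorem eventually_wordAdj_mul_mul_word_eq_zero {z y : X} (hzy : y ≠ z) {α : MulAut G}
    (hz : Φ z = Sum.inl α) {a : 𝒩} (ha : a ∈ wordStateSpan K Φ {u | u ≠ []}) :
    ∀ᶠ k in atTop,
      wordAdj K _ (List.replicate k z ++ [y]) * a * word K _ (List.replicate k z ++ [y]) = 0 := by
  induction ha using Submodule.span_induction with
  | mem a ha =>
    obtain ⟨u, hu, s, -, rfl⟩ := ha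
    filter_upwards [eventually_gt_atTop u.length] with k hk
    have hlen := (length_msAct Φ s (List.replicate k z ++ [y])).ge.trans
      (List.suffix_append u _).length_le
    rw [mul_assoc, mul_assoc, state_mul_word, ← mul_assoc (word K _ u), ← word_append, ← mul_assoc,
      wordAdj_mul_word_eq_zero hlen (not_isPrefix_append_msAct hzy hz hu hk s), zero_mul]
  | zero => simp
  | add a b _ _ iha ihb =>
    filter_upwards [iha, ihb] with k hka hkb
    rw [mul_add, add_mul, hka, hkb, add_zero]
  | smul c a _ iha =>
    filter_upwards [iha] with k hka
    rw [mul_smul_comm, smul_mul_assoc, hka, smul_zero]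

open Finsupp

theorem adj_mul_linearCombination_state_mul_letter {C : G ⊕ H →₀ K} {h : H} {x : X}
    (hC : ∀ s ∈ C.support, msOut s x = h • x → s = Sum.inr h) :
    adj K _ (h • x) * linearCombination K (state K Φ) C * letter K _ x = C (Sum.inr h) • 1 := by
  rw [linearCombination_apply, Finsupp.sum, Finset.mul_sum, Finset.sum_mul,
    Finset.sum_eq_single (Sum.inr h)]
  · rw [mul_smul_comm, smul_mul_assoc, mul_assoc, state_mul_letter, msNext_inr, state_inr_one,
      mul_one, msOut, adj_mul_letter_same]
  · intro s hs hne
    rw [mul_smul_comm, smul_mul_assoc, mul_assoc, state_mul_letter, ← mul_assoc,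
      adj_mul_letter_ne K _ fun e => hne (hC s hs e.symm), zero_mul, smul_zero]
  · intro hs
    rw [notMem_support_iff.1 hs, zero_smul, mul_zero, zero_mul]

theorem wordAdj_mul_linearCombination_state_inl_mul_word {b : G →* H} {v : List X}
    (hv : ∀ c, v.foldl (msNext Φ) (Sum.inl c) = Sum.inr (b c) ∧ msAct Φ (Sum.inl c) v = v)
    (A : G →₀ K) :
    wordAdj K _ v * linearCombination K (fun c => state K Φ (Sum.inl c)) A * word K _ v =
      linearCombination K (state K Φ) ((A.mapDomain b).mapDomain Sum.inr) := by
  rw [linearCombination_mapDomain, linearCombination_mapDomain, linearCombination_apply,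
    linearCombination_apply, Finsupp.sum, Finset.mul_sum, Finset.sum_mul]
  refine Finset.sum_congr rfl fun c _ => ?_
  rw [mul_smul_comm, smul_mul_assoc, mul_assoc, state_mul_word, (hv c).1, (hv c).2, ← mul_assoc,
    wordAdj_mul_word_self, one_mul]
  rfl

theorem exists_linearCombination_state_inl_eq {C : G ⊕ H →₀ K}
    (hC : ∀ h ≠ 1, C (Sum.inr h) = 0) :
    ∃ A : G →₀ K, linearCombination K (fun c => state K Φ (Sum.inl c)) A =
      linearCombination K (state K Φ) C := by
  refine ⟨C.mapDomain (Sum.elim id fun _ => 1), ?_⟩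
  rw [linearCombination_mapDomain, linearCombination_apply, linearCombination_apply]
  refine Finsupp.sum_congr fun s hs => congrArg (C s • ·) ?_
  rcases s with c | h
  · rfl
  · obtain rfl : h = 1 := not_imp_comm.1 (hC h) (mem_support_iff.1 hs)
    exact (state_inl_one K Φ).trans (state_inr_one K Φ).symm

end multispinalGroup

namespace IsMultispinal

open multispinalGroup NekrashevychAlgebra Finsupp

variable {K : Type*} [Field K] {G H X : Type*} [Group G] [Group H] [MulAction H X] [Fintype X]
  {Φ : X → MulAut G ⊕ (G →* H)}

local notation "𝒩" => NekrashevychAlgebra K (multispinalGroup Φ)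

theorem exists_wordAdj_mul_mul_word_eq_smul_one (hΦ : IsMultispinal Φ)
    (hA : ∀ A : G →₀ K, (∀ b ∈ msB Φ, A.mapDomain b = 0) → A = 0) {a : 𝒩}
    (ha : a ∈ wordStateSpan K Φ {[]}) (ha0 : a ≠ 0) :
    ∃ p q : List X, p.length = q.length ∧ ∃ k : K, k ≠ 0 ∧
      wordAdj K _ p * a * word K _ q = k • 1 := by
  have := hΦ.finite_left
  obtain ⟨x, -, -⟩ := hΦ.exists_aut
  obtain ⟨C, rfl⟩ := mem_wordStateSpan_nil.1 ha
  by_cases hC : ∃ h ≠ 1, C (Sum.inr h) ≠ 0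
  · obtain ⟨h, h1, hCh⟩ := hC
    refine ⟨[h • x], [x], rfl, C (Sum.inr h), hCh, ?_⟩
    rw [word_singleton, wordAdj_singleton]
    refine adj_mul_linearCombination_state_mul_letter fun s _ hs => ?_
    rcases s with c | k
    · exact absurd (hΦ.free h x hs.symm) h1
    · exact congrArg Sum.inr (hΦ.eq_of_smul_eq_smul hs)
  · push Not at hC
    obtain ⟨A, hAC⟩ := exists_linearCombination_state_inl_eq (Φ := Φ) hC
    rw [← hAC] at ha0 ⊢
    obtain ⟨b, hb, hbA⟩ : ∃ b ∈ msB Φ, A.mapDomain b ≠ 0 := by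
      by_contra! h
      exact ha0 (by rw [hA A h, map_zero])
    obtain ⟨v, hv⟩ := exists_word_of_mem_msB hb
    obtain ⟨h, hh⟩ := DFunLike.ne_iff.1 hbA
    refine ⟨v ++ [h • x], v ++ [x], by simp, A.mapDomain b h, hh, ?_⟩
    rw [word_append, word_singleton, wordAdj_append, wordAdj_singleton, ← mul_assoc,
      mul_assoc (adj K _ _), mul_assoc (adj K _ _),
      wordAdj_mul_linearCombination_state_inl_mul_word hv,
      adj_mul_linearCombination_state_mul_letter, mapDomain_apply Sum.inr_injective]
    intro s hs hsx
    classical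
    obtain ⟨k, -, rfl⟩ := Finset.mem_image.1 (mapDomain_support hs)
    exact congrArg Sum.inr (hΦ.eq_of_smul_eq_smul hsx)

theorem exists_mul_mul_eq_one (hΦ : IsMultispinal Φ)
    (hA : ∀ A : G →₀ K, (∀ b ∈ msB Φ, A.mapDomain b = 0) → A = 0) {a : 𝒩} (ha : a ≠ 0) :
    ∃ c d, c * a * d = 1 := by
  obtain ⟨z, α, hz⟩ := hΦ.exists_aut
  obtain ⟨y, f, hy⟩ := hΦ.exists_hom
  have hyz : y ≠ z := by
    rintro rfl
    simp [hz] at hy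
  obtain ⟨w, hw, hw0⟩ := exists_mul_word_mem_wordStateSpan ha
  obtain ⟨n, hn⟩ := exists_mem_wordStateSpan_length_le hw
  obtain ⟨v, s, hs, hs0, b, hb, hv⟩ := exists_wordAdj_mul_eq_add hn hw0
  obtain ⟨p, q, hpq, k, hk, hs1⟩ := hΦ.exists_wordAdj_mul_mul_word_eq_smul_one hA hs hs0
  obtain ⟨i, hi⟩ := (eventually_wordAdj_mul_mul_word_eq_zero hyz hz
    (wordAdj_mul_mul_word_mem hpq hb)).exists
  set r := List.replicate i z ++ [y]
  refine ⟨k⁻¹ • (wordAdj K _ r * wordAdj K _ p * wordAdj K _ v),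
    word K _ w * word K _ q * word K _ r, ?_⟩
  calc k⁻¹ • (wordAdj K _ r * wordAdj K _ p * wordAdj K _ v) * a *
        (word K _ w * word K _ q * word K _ r)
      = k⁻¹ • (wordAdj K _ r * (wordAdj K _ p * (wordAdj K _ v * (a * word K _ w)) * word K _ q) *
          word K _ r) := by simp only [smul_mul_assoc, mul_assoc]
    _ = k⁻¹ • (k • (wordAdj K _ r * word K _ r)) := by
      rw [hv, mul_add, add_mul, hs1, mul_add, add_mul, hi, add_zero, mul_smul_comm, mul_one,
        smul_mul_assoc]
    _ = 1 := by rw [wordAdj_mul_word_self, inv_smul_smul₀ hk]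

theorem isSimpleRing_of_forall_mapDomain_eq_zero (hΦ : IsMultispinal Φ)
    (hA : ∀ A : G →₀ K, (∀ b ∈ msB Φ, A.mapDomain b = 0) → A = 0) : IsSimpleRing 𝒩 := by
  obtain ⟨x, -, -⟩ := hΦ.exists_aut
  have : Nonempty X := ⟨x⟩
  exact isSimpleRing_of_exists_mul_mul_eq_one fun a ha => hΦ.exists_mul_mul_eq_one hA ha

end IsMultispinal

namespace multispinalGroup

open SelfSimilarGroup NekrashevychAlgebra Finsupp Filter

variable {G H X : Type*} [Group G] [Group H] [MulAction H X] {Φ : X → MulAut G ⊕ (G →* H)}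

theorem inlHom_smul_cons_of_eq_inr {x : X} {f : G →* H} (hx : Φ x = Sum.inr f) (c : G)
    (w : Stream' X) : inlHom Φ c • w.cons x = (msElem Φ (Sum.inr (f c)) • w).cons x := by
  have := streamAction.smul_cons (msElem Φ (Sum.inl c)) x w
  rwa [out_msElem, sec_msElem, msNext_inl_of_eq_inr hx] at this

theorem inlHom_smul_cons_of_eq_inl {x : X} {α : MulAut G} (hx : Φ x = Sum.inl α) (c : G)
    (w : Stream' X) : inlHom Φ c • w.cons x = (inlHom Φ (α c) • w).cons x := by
  have := streamAction.smul_cons (msElem Φ (Sum.inl c)) x w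
  rwa [out_msElem, sec_msElem, msNext_inl_of_eq_inl hx] at this

theorem exists_sectionAlong_inlHom_eq {w : Stream' X} (hw : ∀ n, ∃ α, Φ (w n) = Sum.inl α) (c : G)
    (n : ℕ) : ∃ d, sectionAlong (inlHom Φ c) w n = inlHom Φ d := by
  induction n with
  | zero => exact ⟨c, rfl⟩
  | succ n ih =>
    obtain ⟨d, hd⟩ := ih
    obtain ⟨α, hα⟩ := hw n
    exact ⟨α d, by rw [sectionAlong, hd, inlHom_apply, sec_msElem, msNext_inl_of_eq_inl hα]; rfl⟩

theorem inlHom_smul_eq_self {w : Stream' X} (hw : ∀ n, ∃ α, Φ (w n) = Sum.inl α) (c : G) :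
    inlHom Φ c • w = w := by
  funext n
  obtain ⟨d, hd⟩ := exists_sectionAlong_inlHom_eq hw c n
  rw [smul_stream_apply, hd, inlHom_apply, out_msElem, msOut]

theorem exists_mem_msB_factorsThrough_of_eq_inr {n : ℕ} {w : Stream' X} {f : G →* H}
    (hf : Φ (w n) = Sum.inr f) :
    ∃ b ∈ msB Φ, Function.FactorsThrough (fun c => inlHom Φ c • w) b := by
  induction n generalizing w with
  | zero =>
    obtain ⟨x, t, rfl⟩ : ∃ x t, w = Stream'.cons x t := ⟨_, _, (Stream'.eta w).symm⟩
    have hx : Φ x = Sum.inr f := hf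
    refine ⟨f, ⟨f, ⟨x, hx⟩, 1, one_mem _, rfl⟩, fun c d hcd => ?_⟩
    simp only [inlHom_smul_cons_of_eq_inr hx, hcd]
  | succ n ih =>
    obtain ⟨x, t, rfl⟩ : ∃ x t, w = Stream'.cons x t := ⟨_, _, (Stream'.eta w).symm⟩
    rcases hx : Φ x with α | f'
    · obtain ⟨_, ⟨f', hf', β, hβ, rfl⟩, h⟩ := ih (w := t) hf
      refine ⟨_, ⟨f', hf', β * α, mul_mem hβ (Subgroup.subset_closure ⟨x, hx⟩), rfl⟩,
        fun c d hcd => ?_⟩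
      simp only [inlHom_smul_cons_of_eq_inl hx]
      exact congrArg (Stream'.cons x) (h hcd)
    · refine ⟨f', ⟨f', ⟨_, hx⟩, 1, one_mem _, rfl⟩, fun c d hcd => ?_⟩
      simp only [inlHom_smul_cons_of_eq_inr hx, hcd]

theorem sectionAlong_inlHom_const {z : X} {α : MulAut G} (hz : Φ z = Sum.inl α) (c : G) (n : ℕ) :
    sectionAlong (inlHom Φ c) (Stream'.const z) n = inlHom Φ ((α ^ n) c) := by
  induction n with
  | zero => rfl
  | succ n ih =>
    rw [sectionAlong, ih, inlHom_apply, sec_msElem, show Stream'.const z n = z from rfl,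
      msNext_inl_of_eq_inl hz, pow_succ', MulAut.mul_apply, inlHom_apply]

end multispinalGroup

namespace IsMultispinal

open SelfSimilarGroup multispinalGroup NekrashevychAlgebra Finsupp Filter

variable {K : Type*} [Field K] {G H X : Type*} [Group G] [Group H] [MulAction H X]
  {Φ : X → MulAut G ⊕ (G →* H)}

theorem exists_mem_msB_factorsThrough (hΦ : IsMultispinal Φ) (w : Stream' X) :
    ∃ b ∈ msB Φ, Function.FactorsThrough (fun c => inlHom Φ c • w) b := by
  by_cases hw : ∃ n f, Φ (w n) = Sum.inr f
  · obtain ⟨n, f, hf⟩ := hw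
    exact exists_mem_msB_factorsThrough_of_eq_inr hf
  · obtain ⟨x, f, hf⟩ := hΦ.exists_hom
    have hw' : ∀ n, ∃ α, Φ (w n) = Sum.inl α := fun n => by
      rcases h : Φ (w n) with α | f
      · exact ⟨α, rfl⟩
      · exact absurd ⟨n, f, h⟩ hw
    exact ⟨f, ⟨f, ⟨x, hf⟩, 1, one_mem _, rfl⟩, fun c d _ => by
      simp only [inlHom_smul_eq_self hw']⟩

theorem mapDomain_inlHom_smul_eq_zero (hΦ : IsMultispinal Φ) {A : G →₀ K}
    (hA : ∀ b ∈ msB Φ, A.mapDomain b = 0) (w : Stream' X) :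
    A.mapDomain (fun c => inlHom Φ c • w) = 0 := by
  obtain ⟨b, hb, h⟩ := hΦ.exists_mem_msB_factorsThrough w
  have : Nonempty (Stream' X) := ⟨w⟩
  obtain ⟨e, he⟩ := (Function.factorsThrough_iff _).1 h
  rw [he, mapDomain_comp, hA b hb, mapDomain_zero]

theorem inlHom_smul_germPoint_injective (hΦ : IsMultispinal Φ) {z : X} {α : MulAut G}
    (hz : Φ z = Sum.inl α) :
    Function.Injective fun c =>
      inlHom Φ c • (⟨Stream'.const z, 1⟩ : GermPoint (multispinalGroup Φ)) := by
  intro c d hcd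
  simp only [smul_germPoint, mul_one, GermPoint.mk.injEq, Germ.coe_eq] at hcd
  obtain ⟨n, hn⟩ := hcd.2.exists
  rw [sectionAlong_inlHom_const hz, sectionAlong_inlHom_const hz] at hn
  exact (α ^ n).injective (hΦ.inlHom_injective hn)

variable [Fintype X]

local notation "𝒩" => NekrashevychAlgebra K (multispinalGroup Φ)

theorem rep_linearCombination_grp_single (Y : Type*) [SelfSimilarAction (multispinalGroup Φ) Y]
    (A : G →₀ K) (y : Y) :
    rep K (multispinalGroup Φ) Y (linearCombination K (fun c => grp K _ (inlHom Φ c)) A)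
      (single y 1) = A.mapDomain fun c => inlHom Φ c • y := by
  simp [linearCombination_apply, Finsupp.sum, rep_grp_single, mapDomain]

theorem not_isSimpleRing_of_mapDomain_eq_zero (hΦ : IsMultispinal Φ) {A : G →₀ K} (hA0 : A ≠ 0)
    (hA : ∀ b ∈ msB Φ, A.mapDomain b = 0) : ¬ IsSimpleRing 𝒩 := by
  intro _
  obtain ⟨z, α, hz⟩ := hΦ.exists_aut
  have : Nonempty (Stream' X) := ⟨Stream'.const z⟩
  have ha : linearCombination K (fun c => grp K (multispinalGroup Φ) (inlHom Φ c)) A = 0 := by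
    refine (rep K _ (Stream' X)).toRingHom.injective (Eq.trans ?_ (map_zero _).symm)
    refine lhom_ext' fun w => LinearMap.ext_ring ?_
    exact (rep_linearCombination_grp_single _ A w).trans (hΦ.mapDomain_inlHom_smul_eq_zero hA w)
  refine hA0 (mapDomain_injective (hΦ.inlHom_smul_germPoint_injective hz) ?_)
  rw [mapDomain_zero, ← rep_linearCombination_grp_single, ha, map_zero, LinearMap.zero_apply]

theorem isSimpleRing_iff (hΦ : IsMultispinal Φ) :
    IsSimpleRing 𝒩 ↔ ∀ A : G →₀ K, (∀ b ∈ msB Φ, A.mapDomain b = 0) → A = 0 :=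
  ⟨fun h _ hA => by_contra fun hA0 => hΦ.not_isSimpleRing_of_mapDomain_eq_zero hA0 hA h,
    hΦ.isSimpleRing_of_forall_mapDomain_eq_zero⟩

end IsMultispinal

/-! ### Group algebras of cyclic groups -/

section CyclicGroups

variable {C : Type*} [CommGroup C]

theorem mem_zpowers_of_orderOf_eq [Finite C] [IsCyclic C] {y z : C} (h : orderOf y = orderOf z) :
    y ∈ Subgroup.zpowers z := by
  have hz : Subgroup.zpowers z = (powMonoidHom (orderOf z)).ker := by
    refine Subgroup.eq_of_le_of_card_ge ?_ ?_
    · rw [Subgroup.zpowers_le, MonoidHom.mem_ker, powMonoidHom_apply, pow_orderOf_eq_one]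
    · rw [IsCyclic.card_powMonoidHom_ker, Nat.gcd_eq_right (orderOf_dvd_natCard z),
        Nat.card_zpowers]
  rw [hz, MonoidHom.mem_ker, powMonoidHom_apply, ← h, pow_orderOf_eq_one]

theorem exists_prime_forall_orderOf_eq_map_eq_one [Finite C] [IsCyclic C] {H : Type*} [Group H]
    {f : C →* H} (hf : ¬ Function.Injective f) :
    ∃ p, p.Prime ∧ p ∣ Nat.card C ∧ ∀ z, orderOf z = p → f z = 1 := by
  obtain ⟨y, hfy, hy⟩ : ∃ y, f y = 1 ∧ y ≠ 1 := by
    simpa [injective_iff_map_eq_one] using hf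
  obtain ⟨p, hp, hpy⟩ := Nat.exists_prime_and_dvd (mt orderOf_eq_one_iff.1 hy)
  refine ⟨p, hp, hpy.trans (orderOf_dvd_natCard y), fun z hz => ?_⟩
  have hy_pow : orderOf (y ^ (orderOf y / p)) = p := orderOf_pow_orderOf_div (orderOf_pos y).ne' hpy
  obtain ⟨k, rfl⟩ :=
    Subgroup.mem_zpowers_iff.1 (mem_zpowers_of_orderOf_eq (hz.trans hy_pow.symm))
  rw [map_zpow, map_pow, hfy, one_pow, one_zpow]

theorem coeff_one_sub_single_mul {R : Type*} [Ring R] (z c : C) (a : MonoidAlgebra R C) :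
    ((1 - MonoidAlgebra.single z 1) * a).coeff c = a.coeff c - a.coeff (z⁻¹ * c) := by
  simp [sub_mul]

theorem pow_prod_eq_one_of_coeff_prod_ne_zero {R : Type*} [CommRing R] {S : Finset ℕ} {z : ℕ → C}
    (hz : ∀ p ∈ S, z p ^ p = 1) {c : C}
    (hc : (∏ p ∈ S, (1 - MonoidAlgebra.single (z p) (1 : R))).coeff c ≠ 0) :
    c ^ ∏ p ∈ S, p = 1 := by
  induction S using Finset.cons_induction generalizing c with
  | empty =>
    rw [Finset.prod_empty, pow_one]
    by_contra h
    simp [MonoidAlgebra.one_def, Ne.symm h] at hc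
  | cons p S hp ih =>
    rw [Finset.forall_mem_cons] at hz
    rw [Finset.prod_cons] at hc ⊢
    rw [coeff_one_sub_single_mul] at hc
    by_cases h : (∏ p ∈ S, (1 - MonoidAlgebra.single (z p) (1 : R))).coeff c = 0
    · rw [h, zero_sub, neg_ne_zero] at hc
      calc c ^ (p * ∏ q ∈ S, q) = ((z p)⁻¹ * c) ^ (p * ∏ q ∈ S, q) := by
            rw [pow_mul, pow_mul, mul_pow _ c, inv_pow, hz.1, inv_one, one_mul]
        _ = 1 := by rw [mul_comm p, pow_mul, ih hz.2 hc, one_pow]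
    · rw [mul_comm p, pow_mul, ih hz.2 h, one_pow]

theorem coeff_one_prod_one_sub_single {R : Type*} [CommRing R] {S : Finset ℕ}
    (hS : ∀ p ∈ S, p.Prime) {z : ℕ → C} (hz : ∀ p ∈ S, orderOf (z p) = p) :
    (∏ p ∈ S, (1 - MonoidAlgebra.single (z p) (1 : R))).coeff 1 = 1 := by
  induction S using Finset.cons_induction with
  | empty => simp [MonoidAlgebra.one_def]
  | cons p S hp ih =>
    rw [Finset.forall_mem_cons] at hS hz
    rw [Finset.prod_cons, coeff_one_sub_single_mul, ih hS.2 hz.2, mul_one, sub_eq_self]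
    by_contra h
    have hdvd := orderOf_dvd_of_pow_eq_one <| pow_prod_eq_one_of_coeff_prod_ne_zero
      (fun q hq => orderOf_dvd_iff_pow_eq_one.1 (hz.2 q hq).dvd) h
    rw [orderOf_inv, hz.1] at hdvd
    obtain ⟨q, hq, hpq⟩ := (hS.1.prime.dvd_finsetProd_iff _).1 hdvd
    exact hp ((Nat.prime_dvd_prime_iff_eq hS.1 (hS.2 q hq)).1 hpq ▸ hq)

theorem exists_ne_zero_forall_mapDomain_eq_zero [Finite C] [IsCyclic C] (R : Type*) [CommRing R]
    [Nontrivial R] (H : Type*) [Group H] :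
    ∃ A : C →₀ R, A ≠ 0 ∧ ∀ f : C →* H, ¬ Function.Injective f → A.mapDomain f = 0 := by
  have hexists : ∀ p ∈ (Nat.card C).primeFactors, ∃ z : C, orderOf z = p := fun p hp =>
    have := Fact.mk (Nat.prime_of_mem_primeFactors hp)
    exists_prime_orderOf_dvd_card' p (Nat.dvd_of_mem_primeFactors hp)
  choose! z hz using hexists
  set A := ∏ p ∈ (Nat.card C).primeFactors, (1 - MonoidAlgebra.single (z p) (1 : R)) with hA
  refine ⟨A.coeff, fun h => one_ne_zero (α := R) ?_, fun f hf => ?_⟩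
  · rw [← coeff_one_prod_one_sub_single (fun _ => Nat.prime_of_mem_primeFactors) hz, ← hA, h,
      Finsupp.zero_apply]
  · obtain ⟨p, hp, hpC, hpf⟩ := exists_prime_forall_orderOf_eq_map_eq_one hf
    have hpS : p ∈ (Nat.card C).primeFactors := Nat.mem_primeFactors.2 ⟨hp, hpC, Nat.card_pos.ne'⟩
    obtain ⟨a, ha⟩ : 1 - MonoidAlgebra.single (z p) (1 : R) ∣ A := Finset.dvd_prod_of_mem _ hpS
    have h0 : MonoidAlgebra.mapDomainRingHom R f A = 0 := by
      rw [ha, map_mul, map_sub, map_one, MonoidAlgebra.mapDomainRingHom_apply,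
        MonoidAlgebra.mapDomain_single, hpf _ (hz p hpS), MonoidAlgebra.one_def, sub_self, zero_mul]
    simpa using congrArg MonoidAlgebra.coeff h0

end CyclicGroups

theorem IsMultispinal.exists_injective_of_isPrimePow {G H X : Type*} [Group G] [IsCyclic G]
    [Group H] [MulAction H X] {Φ : X → MulAut G ⊕ (G →* H)} (hΦ : IsMultispinal Φ)
    (hG : IsPrimePow (Nat.card G)) : ∃ x f, Φ x = Sum.inr f ∧ Function.Injective f := by
  have := hΦ.finite_left
  let _ : CommGroup G := IsCyclic.commGroup
  obtain ⟨p, n, hp, hn, hpn⟩ := (isPrimePow_nat_iff _).1 hG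
  have := Fact.mk hp
  obtain ⟨z, hz⟩ := exists_prime_orderOf_dvd_card' (G := G) p (hpn ▸ dvd_pow_self p hn.ne')
  by_contra! h
  suffices z = 1 by
    rw [this, orderOf_one] at hz
    exact hp.one_lt.ne hz
  refine hΦ.ker_trivial z ?_
  rintro _ ⟨f, ⟨x, hx⟩, α, -, rfl⟩
  obtain ⟨q, hq, hqG, hqf⟩ := exists_prime_forall_orderOf_eq_map_eq_one (h x f hx)
  obtain rfl : q = p :=
    (Nat.prime_dvd_prime_iff_eq hq hp).1 (hq.dvd_of_dvd_pow (hpn.symm ▸ hqG))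
  exact hqf (α z) ((orderOf_injective α.toMonoidHom α.injective z).trans hz)

theorem theoremt_general {G H X : Type*} [Group G] [IsCyclic G] [Group H] [MulAction H X]
    [Fintype X] {Φ : X → MulAut G ⊕ (G →* H)} (hΦ : IsMultispinal Φ) (K : Type*) [Field K] :
    IsSimpleRing (NekrashevychAlgebra K (multispinalGroup Φ)) ↔
      ∃ x f, Φ x = Sum.inr f ∧ Function.Injective f := by
  have := hΦ.finite_left
  let _ : CommGroup G := IsCyclic.commGroup
  rw [hΦ.isSimpleRing_iff]
  refine ⟨fun h => ?_, fun ⟨x, f, hx, hf⟩ A hA => ?_⟩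
  · by_contra! hinj
    obtain ⟨A, hA0, hA⟩ := exists_ne_zero_forall_mapDomain_eq_zero (C := G) K H
    refine hA0 (h A ?_)
    rintro _ ⟨f, ⟨x, hx⟩, α, -, rfl⟩
    refine hA _ fun hfα => hinj x f hx ?_
    simpa using hfα.comp α.symm.injective
  · refine Finsupp.mapDomain_injective hf ?_
    rw [hA f ⟨f, ⟨x, hx⟩, 1, one_mem _, rfl⟩, Finsupp.mapDomain_zero]

namespace IsGGS

variable {m : ℕ} {C : Type*} [Group C] {Φ : ZMod m → MulAut C ⊕ (C →* Multiplicative (ZMod m))}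

theorem bijective_of_injective (hΦ : IsGGS Φ) {f : C →* Multiplicative (ZMod m)}
    (hf : Function.Injective f) : Function.Bijective f := by
  have := hΦ.finite_right
  exact (Nat.bijective_iff_injective_and_card f).2 ⟨hf, hΦ.card_eq.trans (Nat.card_zmod m).symm⟩

theorem exists_injective_iff_exists_bijective [NeZero m] (hΦ : IsGGS Φ) :
    (∃ x f, Φ x = Sum.inr f ∧ Function.Injective f) ↔
      ∃ k : ℕ, k + 2 ≤ m ∧ ∃ f, Φ (k : ZMod m) = Sum.inr f ∧ Function.Bijective f := by
  refine ⟨fun ⟨x, f, hx, hf⟩ => ?_, fun ⟨k, _, f, hx, hf⟩ => ⟨k, f, hx, hf.injective⟩⟩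
  rw [← ZMod.natCast_zmod_val x] at hx
  have hne : x.val ≠ m - 1 := fun h => by
    rw [h, hΦ.last] at hx
    cases hx
  have hlt := x.val_lt
  exact ⟨x.val, by omega, f, hx, hΦ.bijective_of_injective hf⟩

end IsGGS

namespace IsGuptaSidki

variable {p : ℕ} {C : Type*} [Group C] {t : C}
  {Φ : ZMod p → MulAut C ⊕ (C →* Multiplicative (ZMod p))}

theorem exists_injective (hΦ : IsGuptaSidki t Φ) :
    ∃ f, Φ 0 = Sum.inr f ∧ Function.Injective f := by
  have := NeZero.mk hΦ.prime.ne_zero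
  have : Finite C := Nat.finite_of_card_ne_zero (hΦ.card_eq ▸ hΦ.prime.ne_zero)
  obtain ⟨f, hf, hft⟩ := hΦ.zero
  have hsurj : Function.Surjective f := fun a => ⟨t ^ (Multiplicative.toAdd a).val, by
    rw [map_pow, hft, ← ofAdd_nsmul, nsmul_one, ZMod.natCast_zmod_val, ofAdd_toAdd]⟩
  have hcard : Nat.card C = Nat.card (Multiplicative (ZMod p)) :=
    hΦ.card_eq.trans (Nat.card_zmod p).symm
  exact ⟨f, hf, ((Nat.bijective_iff_surjective_and_card f).2 ⟨hsurj, hcard⟩).injective⟩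

theorem isGGS (hΦ : IsGuptaSidki t Φ) : IsGGS Φ := by
  have := NeZero.mk hΦ.prime.ne_zero
  obtain ⟨f, hf, hinj⟩ := hΦ.exists_injective
  exact
    { finite_left := Nat.finite_of_card_ne_zero (hΦ.card_eq ▸ hΦ.prime.ne_zero)
      finite_right := inferInstanceAs (Finite (ZMod p))
      free := fun h x hx => Multiplicative.toAdd.injective (add_eq_right.1 hx)
      exists_aut := ⟨_, _, hΦ.last⟩
      exists_hom := ⟨_, _, hf⟩
      ker_trivial := fun g hg =>
        (injective_iff_map_eq_one f).1 hinj g (hg f ⟨f, ⟨0, hf⟩, 1, one_mem _, rfl⟩)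
      cyclic := isCyclic_iff_exists_zpowers_eq_top.2 ⟨t, hΦ.gen⟩
      card_eq := hΦ.card_eq
      last := hΦ.last
      hom := fun
        | 0, _ => ⟨f, by rw [Nat.cast_zero, hf]⟩
        | 1, _ => let ⟨f₁, hf₁, _⟩ := hΦ.one; ⟨f₁, by rw [Nat.cast_one, hf₁]⟩
        | k + 2, hk => let ⟨f₂, hf₂, _⟩ := hΦ.rest (k + 2) (by omega) hk; ⟨f₂, hf₂⟩ }

end IsGuptaSidki

theorem theoremt {m : ℕ} [NeZero m] (hm : 2 ≤ m) {C : Type v} [Group C]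
    (Φ : ZMod m → MulAut C ⊕ (C →* Multiplicative (ZMod m))) :
    (IsGGS Φ →
      ((∃ k : ℕ, k + 2 ≤ m ∧ ∃ f : C →* Multiplicative (ZMod m),
          Φ (k : ZMod m) = Sum.inr f ∧ Function.Bijective f) →
        ∀ (K : Type u) [Field K], IsSimpleRing (NekrashevychAlgebra K (multispinalGroup Φ))) ∧
      ((¬ ∃ k : ℕ, k + 2 ≤ m ∧ ∃ f : C →* Multiplicative (ZMod m),
          Φ (k : ZMod m) = Sum.inr f ∧ Function.Bijective f) →
        ∀ (K : Type u) [Field K], ¬ IsSimpleRing (NekrashevychAlgebra K (multispinalGroup Φ))) ∧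
      (IsPrimePow m →
        ∀ (K : Type u) [Field K], IsSimpleRing (NekrashevychAlgebra K (multispinalGroup Φ)))) ∧
    (∀ t : C, IsGuptaSidki t Φ →
      ∀ (K : Type u) [Field K], IsSimpleRing (NekrashevychAlgebra K (multispinalGroup Φ))) := by
  refine ⟨fun hΦ => ?_, fun t ht K _ => ?_⟩
  · have := hΦ.cyclic
    simp only [theoremt_general hΦ.toIsMultispinal, hΦ.exists_injective_iff_exists_bijective]
    exact ⟨fun h _ _ => h, fun h _ _ => h, fun hp _ _ =>
      hΦ.exists_injective_iff_exists_bijective.1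
        (hΦ.exists_injective_of_isPrimePow (hΦ.card_eq.symm ▸ hp))⟩
  · have := ht.isGGS.cyclic
    exact (theoremt_general ht.isGGS.toIsMultispinal K).2 ⟨0, ht.exists_injective⟩
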